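/- Let $(\mathsf C=(\mathsf c_{i,j})_{i,j\in I},\mathsf P,\{\alpha_i\},\mathsf P^\vee,\{h_i\})$ be a Cartan datum of finite type with connected Dynkin diagram $\triangle$ (any of the types $A$–$G$), where $\mathsf P$ is the weight lattice (a free abelian group), $\mathsf P^\vee=\operatorname{Hom}_{\mathbb Z}(\mathsf P,\mathbb Z)$, $\langle h_i,\alpha_j\rangle=\mathsf c_{i,j}$, with fundamental weights $\varpi_i\in\mathsf P$, $\langle h_j,\varpi_i\rangle=\delta(i=j)$. Let $(\cdot,\cdot)$ be the $\mathbb Q$-valued symmetric bilinear form on $\mathsf P$ with $\langle h_i,\lambda\rangle=2(\alpha_i,\lambda)/(\alpha_i,\alpha_i)$, normalized so that $(\alpha,\alpha)=2$ for short roots $\alpha$. Put $d_i=(\alpha_i,\alpha_i)/2$ and $s_i\lambda=\lambda-\langle h_i,\lambda\rangle\alpha_i$. A Dynkin quiver is a pair $Q=(\triangle,\xi)$ with a height function $\xi:I\to\mathbb Z$ satisfying $|\xi_i-\xi_j|=1$ whenever $i,j$ are adjacent in $\triangle$. A vertex $i$ is a source of $Q$ if $\xi_i>\xi_j$ for all neighbours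 $j$ of $i$, and then $s_iQ=(\triangle,s_i\xi)$ with $(s_i\xi)_j=\xi_j-2\delta(i=j)$. Let $r\in\mathbb Z_{\ge1}\sqcup\{\infty\}$ and $J=\{k\in\mathbb Z\mid 1\le k\le r\}$ (so $J=\mathbb Z_{\ge 1}$ if $r=\infty$). A sequence $\widetilde w=(i_k)_{k\in J}$ in $I$ is $Q$-adapted if $i_k$ is a source of $s_{i_{k-1}}\cdots s_{i_1}Q$ for every $k\in J$. For such a sequence set $w_{\le t}=s_{i_1}\cdots s_{i_t}$ and $k^+=\min(\{j\in J\mid k<j,\ i_j=i_k\}\cup\{r+1\})$ (with $\infty+1=\infty$), $J_f=\{k\in J\mid k^+=r+1\}$, $J_e=J\setminus J_f$. Let $\widetilde{\mathsf B}^{\widetilde w}=(b_{s,t})_{s\in J,\,t\in J_e}$ be given by $$b_{s,t}=\begin{cases}1&\text{if }t=s^+,\\-1&\text{if }s=t^+,\\ \mathsf c_{i_s,i_t}&\text{if }s<t<s^+<t^+,\\-\mathsf c_{i_s,i_t}&\text{if }t<s<t^+<s^+,\\0&\text{otherwise,}\end{cases}$$ and let $\Lambda^{\widetilde w}=(\Lambda_{s,t})_{s,t\in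 J}$ be the skew-symmetric matrix with $$\Lambda_{s,t}=(\varpi_{i_s}-w_{\le s}\varpi_{i_s},\ \varpi_{i_t}+w_{\le t}\varpi_{i_t})\qquad\text{for }s<t.$$ Theorem. If $\widetilde w$ is $Q$-adapted for some Dynkin quiver $Q$ on $\triangle$, then the pair $(\Lambda^{\widetilde w},\widetilde{\mathsf B}^{\widetilde w})$ is compatible: the $d_i$ are positive integers, $\Lambda^{\widetilde w}$ has integer entries, every column of $\widetilde{\mathsf B}^{\widetilde w}$ has finitely many nonzero entries (so that the product below makes sense also for $r=\infty$), and $$\Lambda^{\widetilde w}\,\widetilde{\mathsf B}^{\widetilde w}=\bigl(-2d_{i_s}\,\delta(s=t)\bigr)_{s\in J,\;t\in J_e}.$$ -/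

import Mathlib

/-- A generalized symmetrizable Cartan matrix with index set `I`. -/
structure IsSymmetrizableGCM {I : Type*} (C : Matrix I I ℤ) : Prop where
  diag : ∀ i, C i i = 2
  offDiag_nonpos : ∀ i j, i ≠ j → C i j ≤ 0
  zero_symm : ∀ i j, C i j = 0 → C j i = 0
  symmetrizable : ∃ D : I → ℚ, (∀ i, 0 < D i) ∧ ∀ i j, D i * (C i j : ℚ) = D j * (C j i : ℚ)

/-- A Cartan datum `(C, P, Π, P^∨, Π^∨)`, together with a choice of fundamental weights and of an
invariant symmetric bilinear form.  The weight lattice is the free abelian group `P`, the coweight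
lattice is its dual `Hom_ℤ(P, ℤ)`, and `⟨h_i, λ⟩` is `coroot i λ`.  Since `P` is torsion-free,
linear independence over `ℤ` is the same as over `ℚ`. -/
structure CartanDatum (I P : Type*) [AddCommGroup P] where
  /-- the generalized Cartan matrix `C = (c_{i,j})` -/
  cartan : Matrix I I ℤ
  isGCM : IsSymmetrizableGCM cartan
  /-- the simple roots `α_i` -/
  root : I → P
  /-- the simple coroots `h_i` -/
  coroot : I → Module.Dual ℤ P
  coroot_root : ∀ i j, coroot i (root j) = cartan i j
  linearIndependent_root : LinearIndependent ℤ root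
  /-- the fundamental weights `ϖ_i` -/
  fund : I → P
  coroot_fund_same : ∀ i, coroot i (fund i) = 1
  coroot_fund_of_ne : ∀ i j, i ≠ j → coroot j (fund i) = 0
  /-- the `ℚ`-valued bilinear form `(·, ·)` on `P` -/
  form : P →ₗ[ℤ] P →ₗ[ℤ] ℚ
  form_symm : ∀ x y, form x y = form y x
  form_root_pos : ∀ i, 0 < form (root i) (root i)
  coroot_eq_form : ∀ i x, (coroot i x : ℚ) = 2 * form (root i) x / form (root i) (root i)

namespace CartanDatum

variable {I P : Type*} [AddCommGroup P] (D : CartanDatum I P)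

theorem coroot_root_same (i : I) : D.coroot i (D.root i) = 2 := by
  rw [D.coroot_root, D.isGCM.diag]

/-- The simple reflection `s_i λ = λ - ⟨h_i, λ⟩ α_i`, an automorphism of `P`. -/
def simpleRefl (i : I) : P ≃ₗ[ℤ] P := Module.reflection (D.coroot_root_same i)

/-- The Weyl group, the subgroup of `Aut(P)` generated by the simple reflections. -/
def weylGroup : Subgroup (P ≃ₗ[ℤ] P) := Subgroup.closure (Set.range D.simpleRefl)

/-- The (real) roots: the Weyl group translates of the simple roots.  In finite type these are all
the roots. -/
def roots : Set P := {β | ∃ w ∈ D.weylGroup, ∃ i, β = w (D.root i)}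

/-- The Dynkin diagram as a graph: distinct vertices `i`, `j` are joined by an edge when
`c_{i,j} < 0` (equivalently `c_{j,i} < 0`). -/
def diagram : SimpleGraph I := SimpleGraph.fromRel fun i j => D.cartan i j < 0

/-- The datum has finite type: there are finitely many simple roots and the symmetrized Cartan
matrix `((α_i, α_j))` is positive definite. -/
def IsFiniteType : Prop :=
  Finite I ∧ (Matrix.of fun i j => D.form (D.root i) (D.root j)).PosDef

/-- The bilinear form is normalized so that `(α, α) = 2` for short roots `α`. -/
def IsNormalized : Prop := IsLeast ((fun β => D.form β β) '' D.roots) 2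

/-- `d_i = (α_i, α_i) / 2`. -/
def d (i : I) : ℚ := D.form (D.root i) (D.root i) / 2

/-- A Dynkin quiver on the Dynkin diagram, given by a height function `ξ` with
`|ξ_i - ξ_j| = 1` on edges; the arrow on an edge goes from the larger to the smaller height. -/
structure DynkinQuiver where
  /-- the height function -/
  height : I → ℤ
  abs_height_sub : ∀ i j, D.diagram.Adj i j → |height i - height j| = 1

/-- `i` is a source for the height function `ξ`. -/
def IsSource (ξ : I → ℤ) (i : I) : Prop := ∀ j, D.diagram.Adj i j → ξ j < ξ i

open Classical in
/-- The height function `s_i ξ`, with `(s_i ξ)_j = ξ_j - 2 δ(i = j)`. -/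
noncomputable def reflHeight (i : I) (ξ : I → ℤ) : I → ℤ :=
  fun j => ξ j - if i = j then 2 else 0

/-- The height function of `s_{i_k} ⋯ s_{i_1} Q`, where `ξ` is that of `Q`. -/
noncomputable def iterHeight (ξ : I → ℤ) (i : ℕ → I) : ℕ → I → ℤ
  | 0 => ξ
  | k + 1 => reflHeight (i (k + 1)) (iterHeight ξ i k)

/-- The sequence `(i_k)_{1 ≤ k ≤ r}`, `r` finite or infinite, is `Q`-adapted: for `1 ≤ k ≤ r` the
vertex `i_k` is a source of `s_{i_{k-1}} ⋯ s_{i_1} Q`. -/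
def IsAdapted (Q : D.DynkinQuiver) (r : ℕ∞) (i : ℕ → I) : Prop :=
  ∀ k : ℕ, 1 ≤ k → (k : ℕ∞) ≤ r → D.IsSource (iterHeight Q.height i (k - 1)) (i k)

/-- `w_{≤ k} = s_{i_1} ⋯ s_{i_k}`. -/
def wLe (i : ℕ → I) : ℕ → (P ≃ₗ[ℤ] P)
  | 0 => 1
  | k + 1 => wLe i k * D.simpleRefl (i (k + 1))

/-- The index set `J = [1, r]` (all positive integers if `r = ∞`).  For a sequence `i : ℕ → I` only
the values `i k` with `k ∈ J` are used. -/
abbrev J (r : ℕ∞) : Type := {k : ℕ // 1 ≤ k ∧ (k : ℕ∞) ≤ r}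

/-- `k^+ = min ({s ∈ J | k < s, i_s = i_k} ∪ {r + 1})`, where `r + 1 = ∞` if `r = ∞`. -/
noncomputable def next (r : ℕ∞) (i : ℕ → I) (k : J r) : ℕ∞ :=
  sInf ({m : ℕ∞ | ∃ s : J r, k < s ∧ i s = i k ∧ m = (s : ℕ)} ∪ {r + 1})

/-- `J_e = J \ J_f`, where `J_f = {k ∈ J | k^+ = r + 1}`. -/
abbrev Je (r : ℕ∞) (i : ℕ → I) : Type := {k : J r // next r i k ≠ r + 1}

open Classical in
/-- The `J × J_e` exchange matrix `B̃ = (b_{s,t})`. -/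
noncomputable def B (r : ℕ∞) (i : ℕ → I) : Matrix (J r) (Je r i) ℤ :=
  Matrix.of fun s t =>
    let s' : ℕ∞ := (s : ℕ)
    let t' : ℕ∞ := (t.1 : ℕ)
    if t' = next r i s then 1
    else if s' = next r i t.1 then -1
    else if s' < t' ∧ t' < next r i s ∧ next r i s < next r i t.1 then D.cartan (i s) (i t.1)
    else if t' < s' ∧ s' < next r i t.1 ∧ next r i t.1 < next r i s then -D.cartan (i s) (i t.1)
    else 0

/-- The number `(ϖ_{i_s} - w_{≤ s} ϖ_{i_s}, ϖ_{i_t} + w_{≤ t} ϖ_{i_t})`. -/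
def lambdaUpper (i : ℕ → I) (s t : ℕ) : ℚ :=
  D.form (D.fund (i s) - D.wLe i s (D.fund (i s))) (D.fund (i t) + D.wLe i t (D.fund (i t)))

/-- The skew-symmetric `J × J` matrix `Λ`. -/
def Lam (r : ℕ∞) (i : ℕ → I) : Matrix (J r) (J r) ℚ :=
  Matrix.of fun s t =>
    if s < t then D.lambdaUpper i s t
    else if t < s then -D.lambdaUpper i t s
    else 0

end CartanDatum

namespace CartanDatum

variable {I P : Type*} [AddCommGroup P] (D : CartanDatum I P)

/-! ### The Weyl group and the form -/

/-! The compatibility is a telescoping identity. Write `last i l p` for the last occurrence of l up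
to position p, and attach to each position p + 1 with letter j the vector E_p = e_{last(j,p)} -
e_{last(j,p+1)} + Σ_l c_{l,j} e_{last(l,p+1)}, where e_0 = 0. Column t of B̃ is E_{t-1} - E_{t⁺-1}
(`B_eq_sum`).

Since w_{≤ p} ϖ_l changes only when the letter l occurs, Λ at a last occurrence can be evaluated
with w_{≤ p} itself. The relation s_j α_j = -α_j (`wLe_add_wLe_pred`) then reduces row s of Λ
applied to E_p to (ϖ - wϖ, α_j) if s ≤ p and to -(α_j, ϖ + wϖ) if s > p, with ϖ = ϖ_{i_s} and w =
w_{≤ s}. Both are independent of p apart from j, so the two terms of column t cancel unless t ≤ s <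
t⁺. In that range they leave -2(α_j, ϖ_{i_s}), which is nonzero only for s = t, because j does not
recur before t⁺ (`lamNat_exchange_sub`).

Integrality of Λ follows from that of d, as ϖ - wϖ lies in the root lattice. Integrality of d is a
Cauchy–Schwarz argument against a short simple root (`exists_int_d_eq`). -/

theorem simpleRefl_apply (j : I) (x : P) :
    D.simpleRefl j x = x - D.coroot j x • D.root j := by
  simp [simpleRefl, Module.reflection_apply]

theorem form_root_eq (j : I) (x : P) :
    D.form (D.root j) x = D.d j * (D.coroot j x : ℚ) := by
  have h := D.form_root_pos j
  rw [D.coroot_eq_form, d]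
  field_simp

theorem d_pos (j : I) : 0 < D.d j := half_pos (D.form_root_pos j)

theorem form_root_self (j : I) : D.form (D.root j) (D.root j) = 2 * D.d j := by
  rw [d]; ring

theorem form_simpleRefl (j : I) (x y : P) :
    D.form (D.simpleRefl j x) (D.simpleRefl j y) = D.form x y := by
  simp only [simpleRefl_apply, map_sub, LinearMap.sub_apply, map_zsmul, LinearMap.smul_apply,
    D.form_symm x (D.root j), D.form_root_eq j, D.coroot_root_same, zsmul_eq_mul]
  push_cast
  ring

theorem form_weylGroup {w : P ≃ₗ[ℤ] P} (hw : w ∈ D.weylGroup) :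
    ∀ x y : P, D.form (w x) (w y) = D.form x y := by
  induction hw using Subgroup.closure_induction with
  | mem g hg =>
    obtain ⟨j, rfl⟩ := hg
    exact D.form_simpleRefl j
  | one => exact fun _ _ => rfl
  | mul a b _ _ ha hb =>
    intro x y
    rw [LinearEquiv.mul_apply, LinearEquiv.mul_apply, ha, hb]
  | inv a _ ha =>
    intro x y
    rw [← ha (a⁻¹ x), ← LinearEquiv.mul_apply, ← LinearEquiv.mul_apply, mul_inv_cancel]
    rfl

theorem simpleRefl_mem (j : I) : D.simpleRefl j ∈ D.weylGroup :=
  Subgroup.subset_closure ⟨j, rfl⟩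

theorem wLe_mem (i : ℕ → I) (p : ℕ) : D.wLe i p ∈ D.weylGroup := by
  induction p with
  | zero => exact one_mem _
  | succ p ih => exact mul_mem ih (D.simpleRefl_mem _)

theorem weylGroup_apply_sub_mem {w : P ≃ₗ[ℤ] P} (hw : w ∈ D.weylGroup) :
    ∀ x : P, x - w x ∈ Submodule.span ℤ (Set.range D.root) := by
  induction hw using Subgroup.closure_induction with
  | mem g hg =>
    obtain ⟨j, rfl⟩ := hg
    intro x
    rw [simpleRefl_apply, sub_sub_cancel]
    exact Submodule.smul_mem _ _ (Submodule.subset_span ⟨j, rfl⟩)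
  | one => intro x; simp
  | mul a b _ _ ha hb =>
    intro x
    rw [LinearEquiv.mul_apply, ← sub_add_sub_cancel x (b x)]
    exact add_mem (hb x) (ha _)
  | inv a _ ha =>
    intro x
    have h := neg_mem (ha (a⁻¹ x))
    rwa [← LinearEquiv.mul_apply, mul_inv_cancel, neg_sub] at h

theorem weylGroup_apply_of_coroot_eq_zero {x : P} (hx : ∀ j, D.coroot j x = 0)
    {w : P ≃ₗ[ℤ] P} (hw : w ∈ D.weylGroup) : w x = x := by
  induction hw using Subgroup.closure_induction with
  | mem g hg =>
    obtain ⟨j, rfl⟩ := hg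
    simp [simpleRefl_apply, hx]
  | one => rfl
  | mul a b _ _ ha hb => rw [LinearEquiv.mul_apply, hb, ha]
  | inv a _ ha =>
    rw [← ha, ← LinearEquiv.mul_apply, inv_mul_cancel, ha]
    rfl

theorem simpleRefl_fund_of_ne {j k : I} (h : k ≠ j) : D.simpleRefl j (D.fund k) = D.fund k := by
  rw [simpleRefl_apply, D.coroot_fund_of_ne k j h, zero_smul, sub_zero]

/-- The difference of `α_j` and its expansion in fundamental weights is killed by all coroots. -/
theorem coroot_root_sub_sum_fund [Fintype I] (j k : I) :
    D.coroot k (D.root j - ∑ l, D.cartan l j • D.fund l) = 0 := by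
  classical
  rw [map_sub, map_sum, Finset.sum_eq_single k]
  · rw [map_zsmul, D.coroot_fund_same, D.coroot_root]; simp
  · intro l _ hl
    rw [map_zsmul, D.coroot_fund_of_ne l k hl, smul_zero]
  · simp

/-! ### Integrality of `d` and of `Λ` -/

theorem form_self_nonneg (hfin : D.IsFiniteType) {x : P}
    (hx : x ∈ Submodule.span ℤ (Set.range D.root)) : 0 ≤ D.form x x := by
  obtain ⟨_, hpos⟩ := hfin
  obtain ⟨c, rfl⟩ := (Finsupp.mem_span_range_iff_exists_finsupp).1 hx
  have h := hpos.posSemidef.2 (c.mapRange (fun n : ℤ => (n : ℚ)) (by simp))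
  simp only [Finsupp.sum, map_sum, LinearMap.sum_apply, map_zsmul, LinearMap.smul_apply,
    zsmul_eq_mul]
  refine h.trans_eq ?_
  rw [Finsupp.sum_mapRange_index (by simp), Finsupp.sum]
  refine Finset.sum_congr rfl fun a _ => ?_
  rw [Finsupp.sum_mapRange_index (by simp), Finsupp.sum, Finset.mul_sum]
  refine Finset.sum_congr rfl fun b _ => ?_
  simp only [star_trivial, Matrix.of_apply]
  rw [D.form_symm]
  ring

/-- Induction along a path from k to j: if h_a kills w α_j but the next vertex b does not, then s_b
adds a nonzero multiple of α_b, which h_a detects. -/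
theorem exists_weylGroup_coroot_ne_zero (hconn : D.diagram.Connected) (j k : I) :
    ∃ w ∈ D.weylGroup, D.coroot k (w (D.root j)) ≠ 0 := by
  have hadj : ∀ a b, D.diagram.Adj a b → D.cartan b a ≠ 0 := by
    rintro a b ⟨_, h | h⟩ h0
    · exact h.ne (D.isGCM.zero_symm _ _ h0)
    · exact h.ne h0
  obtain ⟨p⟩ := hconn.preconnected k j
  induction p with
  | nil => exact ⟨1, one_mem _, by simp [D.coroot_root_same]⟩
  | @cons a b c h p ih =>
    obtain ⟨w, hw, hne⟩ := ih
    by_cases h0 : D.coroot a (w (D.root c)) = 0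
    · refine ⟨D.simpleRefl b * w, mul_mem (D.simpleRefl_mem b) hw, ?_⟩
      rw [LinearEquiv.mul_apply, simpleRefl_apply, map_sub, h0, map_zsmul, D.coroot_root, zero_sub,
        neg_ne_zero, smul_eq_mul]
      exact mul_ne_zero hne (hadj b a h.symm)
    · exact ⟨w, hw, h0⟩

theorem exists_d_eq_one (hnorm : D.IsNormalized) : ∃ j, D.d j = 1 := by
  obtain ⟨⟨_, ⟨w, hw, j, rfl⟩, hβ⟩, _⟩ := hnorm
  refine ⟨j, ?_⟩
  simp only [D.form_weylGroup hw] at hβ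
  rw [d, hβ]; norm_num

theorem one_le_d (hnorm : D.IsNormalized) (j : I) : 1 ≤ D.d j := by
  have h : (2 : ℚ) ≤ D.form (D.root j) (D.root j) :=
    hnorm.2 ⟨D.root j, ⟨1, one_mem _, j, rfl⟩, rfl⟩
  rw [d]; linarith

/-- Pair a short simple root α_k with a non-orthogonal translate β of α_j. The two coroot pairings
m, n satisfy m = d_j n, and Cauchy–Schwarz gives d_j n² ≤ 4. As d_j ≥ 1, either n = ±1 and d_j = ±m,
or n = ±2 and d_j = 1. -/
theorem exists_int_d_eq (hfin : D.IsFiniteType) (hconn : D.diagram.Connected)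
    (hnorm : D.IsNormalized) (j : I) : ∃ m : ℤ, 0 < m ∧ D.d j = m := by
  obtain ⟨k, hk⟩ := D.exists_d_eq_one hnorm
  obtain ⟨w, hw, hm⟩ := D.exists_weylGroup_coroot_ne_zero hconn j k
  have hd := D.one_le_d hnorm j
  set β := w (D.root j) with hβ
  set m := D.coroot k β with hmdef
  have hform : D.form (D.root k) β = m := by rw [form_root_eq, hk, one_mul]
  set n := D.coroot j (w⁻¹ (D.root k)) with hndef
  have hmn : (m : ℚ) = D.d j * n := by
    rw [hndef, ← form_root_eq, ← D.form_weylGroup hw, ← LinearEquiv.mul_apply, mul_inv_cancel,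
      D.form_symm, ← hform]
    rfl
  have hββ : D.form β β = 2 * D.d j := by rw [hβ, D.form_weylGroup hw, form_root_self]
  have hmem : β ∈ Submodule.span ℤ (Set.range D.root) := by
    have h1 : D.root j ∈ Submodule.span ℤ (Set.range D.root) := Submodule.subset_span ⟨j, rfl⟩
    simpa using sub_mem h1 (D.weylGroup_apply_sub_mem hw (D.root j))
  -- Twice the component of β orthogonal to α_k; its norm is 8 d_j - 2m².
  have hpos := D.form_self_nonneg hfin (x := (2 : ℤ) • β - m • D.root k)
    (sub_mem (Submodule.smul_mem _ _ hmem)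
      (Submodule.smul_mem _ _ (Submodule.subset_span ⟨k, rfl⟩)))
  simp only [map_sub, LinearMap.sub_apply, map_zsmul, LinearMap.smul_apply, hform, hββ,
    D.form_symm β, form_root_self, hk, zsmul_eq_mul] at hpos
  push_cast at hpos
  have hn0 : n ≠ 0 := by
    rintro h
    rw [h, Int.cast_zero, mul_zero] at hmn
    exact hm (by exact_mod_cast hmn)
  have hdn : D.d j * n ^ 2 ≤ 4 := by
    rw [hmn] at hpos
    have : 0 ≤ 2 * D.d j * (4 - D.d j * n ^ 2) := by nlinarith
    nlinarith [nonneg_of_mul_nonneg_right this (by linarith)]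
  have hn4 : n ^ 2 ≤ 4 := by
    have h2 : (n : ℚ) ^ 2 ≤ 4 := by nlinarith [sq_nonneg (n : ℚ)]
    exact_mod_cast h2
  have hd0 := D.d_pos j
  suffices h : ∃ m : ℤ, D.d j = m by
    obtain ⟨a, ha⟩ := h
    exact ⟨a, by rw [ha] at hd0; exact_mod_cast hd0, ha⟩
  have h1 : n ≤ 2 := by nlinarith
  have h2 : -2 ≤ n := by nlinarith
  clear_value n m
  interval_cases n
  · exact ⟨1, by push_cast at hdn ⊢; linarith⟩
  · exact ⟨-m, by push_cast at hmn ⊢; linarith⟩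
  · exact absurd rfl hn0
  · exact ⟨m, by push_cast at hmn ⊢; linarith⟩
  · exact ⟨1, by push_cast at hdn ⊢; linarith⟩

theorem exists_int_form_eq (hd : ∀ j : I, ∃ m : ℤ, D.d j = m) {x : P}
    (hx : x ∈ Submodule.span ℤ (Set.range D.root)) (y : P) : ∃ m : ℤ, D.form x y = m := by
  induction hx using Submodule.span_induction with
  | mem x hx =>
    obtain ⟨j, rfl⟩ := hx
    obtain ⟨m, hm⟩ := hd j
    exact ⟨m * D.coroot j y, by rw [form_root_eq, hm]; push_cast; rfl⟩
  | zero => exact ⟨0, by simp⟩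
  | add a b _ _ ha hb =>
    obtain ⟨m, hm⟩ := ha
    obtain ⟨n, hn⟩ := hb
    exact ⟨m + n, by simp [hm, hn]⟩
  | smul c a _ ha =>
    obtain ⟨m, hm⟩ := ha
    exact ⟨c * m, by simp [hm]⟩

theorem exists_int_lambdaUpper_eq (hd : ∀ j : I, ∃ m : ℤ, D.d j = m) (i : ℕ → I) (s t : ℕ) :
    ∃ m : ℤ, D.lambdaUpper i s t = m :=
  D.exists_int_form_eq hd (D.weylGroup_apply_sub_mem (D.wLe_mem i s) _) _

/-! ### Last occurrences -/

open Classical in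
/-- The last position `u ≤ p` with `1 ≤ u` and `i u = j`, or `0` if there is none. -/
noncomputable def last (i : ℕ → I) (j : I) : ℕ → ℕ
  | 0 => 0
  | p + 1 => if i (p + 1) = j then p + 1 else last i j p

theorem last_le (i : ℕ → I) (j : I) (p : ℕ) : last i j p ≤ p := by
  induction p with
  | zero => exact le_rfl
  | succ p ih => rw [last]; split_ifs <;> omega

theorem apply_last (i : ℕ → I) (j : I) (p : ℕ) (h : last i j p ≠ 0) : i (last i j p) = j := by
  induction p with
  | zero => exact absurd rfl h
  | succ p ih =>
    rw [last] at h ⊢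
    split_ifs at h ⊢ with h1
    · exact h1
    · exact ih h

theorem last_self (i : ℕ → I) (p : ℕ) : last i (i p) p = p := by
  cases p with
  | zero => rfl
  | succ p => simp [last]

theorem eq_last_iff (i : ℕ → I) {u : ℕ} (hu : 1 ≤ u) (p : ℕ) :
    u = last i (i u) p ↔ u ≤ p ∧ ∀ v, u < v → v ≤ p → i v ≠ i u := by
  induction p with
  | zero => simp only [last]; omega
  | succ p ih =>
    rw [last]
    split_ifs with h
    · constructor
      · rintro rfl
        exact ⟨le_rfl, fun v h1 h2 => by omega⟩
      · rintro ⟨h1, h2⟩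
        by_contra h3
        exact h2 (p + 1) (by omega) le_rfl h
    · rw [ih]
      constructor
      · rintro ⟨h1, h2⟩
        refine ⟨by omega, fun v h3 h4 => ?_⟩
        rcases Nat.lt_or_ge p v with h5 | h5
        · obtain rfl : v = p + 1 := by omega
          exact h
        · exact h2 v h3 h5
      · rintro ⟨h1, h2⟩
        have : u ≠ p + 1 := by rintro rfl; exact h rfl
        exact ⟨by omega, fun v h3 h4 => h2 v h3 (by omega)⟩

theorem wLe_succ_fund_of_ne (i : ℕ → I) {j : I} {p : ℕ} (h : i (p + 1) ≠ j) :
    D.wLe i (p + 1) (D.fund j) = D.wLe i p (D.fund j) := by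
  rw [wLe, LinearEquiv.mul_apply, D.simpleRefl_fund_of_ne h.symm]

theorem wLe_fund_eq (i : ℕ → I) (j : I) {p q : ℕ} (h1 : last i j p ≤ q) (h2 : q ≤ p) :
    D.wLe i q (D.fund j) = D.wLe i p (D.fund j) := by
  induction p with
  | zero => rw [Nat.le_zero.1 h2]
  | succ p ih =>
    rcases h2.eq_or_lt with rfl | h3
    · rfl
    · rw [last] at h1
      split_ifs at h1 with h4
      · omega
      · rw [D.wLe_succ_fund_of_ne i h4, ih h1 (by omega)]

/-! ### The entries of `Λ` at last occurrences -/

/-- The bilinear pairing `(ϖ_j - w_{≤ p} ϖ_j, ϖ_k + w_{≤ q} ϖ_k)`. -/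
def pairing (i : ℕ → I) (j : I) (p : ℕ) (k : I) (q : ℕ) : ℚ :=
  D.form (D.fund j - D.wLe i p (D.fund j)) (D.fund k + D.wLe i q (D.fund k))

/-- With the same w on both sides, invariance cancels (ϖ_j, ϖ_k) against (wϖ_j, wϖ_k), leaving only
the antisymmetric cross terms. -/
theorem pairing_antisymm (i : ℕ → I) (j k : I) (p : ℕ) :
    -D.pairing i j p k p = D.pairing i k p j p := by
  have h := D.form_weylGroup (D.wLe_mem i p) (D.fund j) (D.fund k)
  have h' := D.form_weylGroup (D.wLe_mem i p) (D.fund k) (D.fund j)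
  simp only [pairing, map_sub, map_add, LinearMap.sub_apply, h, h',
    D.form_symm (D.fund k) (D.fund j), D.form_symm (D.wLe i p (D.fund k)) (D.fund j),
    D.form_symm (D.fund k) (D.wLe i p (D.fund j))]
  ring

/-- The entry `Λ_{s,u}` as a function on all natural numbers; it vanishes at `u = 0`. -/
def lamNat (i : ℕ → I) (s u : ℕ) : ℚ :=
  if s < u then D.lambdaUpper i s u else if u < s then -D.lambdaUpper i u s else 0

theorem lamNat_of_le (i : ℕ → I) {s u : ℕ} (h : u ≤ s) :
    D.lamNat i s u = -D.pairing i (i u) u (i s) s := by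
  rcases h.eq_or_lt with rfl | h
  · have := D.pairing_antisymm i (i u) (i u) u
    simp only [lamNat, lt_irrefl, if_false]
    linarith
  · rw [lamNat, if_neg (by omega), if_pos h]
    rfl

theorem pairing_last (i : ℕ → I) (j : I) (p : ℕ) (k : I) (q : ℕ) :
    D.pairing i (i (last i j p)) (last i j p) k q = D.pairing i j p k q := by
  have h := D.wLe_fund_eq i j le_rfl (last_le i j p)
  by_cases h0 : last i j p = 0
  -- With no occurrence of j, `i 0` is a junk letter, but w_{≤ 0} = 1 makes both pairings zero.
  · rw [h0] at h ⊢
    rw [pairing, pairing, ← h]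
    simp [wLe]
  · rw [apply_last i j p h0, pairing, pairing, h]

theorem lamNat_last_of_le (i : ℕ → I) (j : I) {s p : ℕ} (h : p ≤ s) :
    D.lamNat i s (last i j p) = -D.pairing i j p (i s) s := by
  rw [D.lamNat_of_le i ((last_le i j p).trans h), pairing_last]

/-- The last occurrence of j may precede s. Then w_{≤ q} ϖ_j is constant for s ≤ q ≤ p, so both
weights may be taken at level s, where the pairing is antisymmetric. -/
theorem lamNat_last_of_ge (i : ℕ → I) (j : I) {s p : ℕ} (h : s ≤ p) :
    D.lamNat i s (last i j p) = D.pairing i (i s) s j p := by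
  have hw := D.wLe_fund_eq i j le_rfl (last_le i j p)
  rcases Nat.lt_or_ge s (last i j p) with h1 | h1
  · rw [lamNat, if_pos h1, lambdaUpper, apply_last i j p (by omega), hw, pairing]
  · rw [D.lamNat_of_le i h1, pairing_last]
    have h2 := D.wLe_fund_eq i j h1 h
    rw [pairing, ← h2, ← pairing, pairing_antisymm, pairing, h2, ← pairing]

/-! ### The exchange relation between the entries of `Λ` -/

/-- The first difference is w_{≤ p} α_j = -w_{≤ p+1} α_j, and α_j - Σ_l c_{l,j} ϖ_l is
Weyl-invariant. This correction term is needed because P may have rank larger than the number of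
simple roots. -/
theorem wLe_add_wLe_pred [Fintype I] (i : ℕ → I) (p : ℕ) :
    D.wLe i p (D.fund (i (p + 1))) - D.wLe i (p + 1) (D.fund (i (p + 1))) +
        ∑ l, D.cartan l (i (p + 1)) • D.wLe i (p + 1) (D.fund l) =
      -(D.root (i (p + 1)) - ∑ l, D.cartan l (i (p + 1)) • D.fund l) := by
  set j := i (p + 1) with hj
  have h := D.weylGroup_apply_of_coroot_eq_zero (D.coroot_root_sub_sum_fund j)
    (D.wLe_mem i (p + 1))
  have hroot : D.wLe i (p + 1) (D.root j) = -D.wLe i p (D.root j) := by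
    rw [wLe, LinearEquiv.mul_apply, ← hj, simpleRefl_apply, coroot_root_same, ← map_neg]
    congr 1
    module
  have hfund : D.wLe i (p + 1) (D.fund j) = D.wLe i p (D.fund j) - D.wLe i p (D.root j) := by
    rw [wLe, LinearEquiv.mul_apply, ← hj, simpleRefl_apply, coroot_fund_same, one_smul, map_sub]
  have hs : ∑ l, D.cartan l j • D.wLe i (p + 1) (D.fund l) =
      D.wLe i (p + 1) (∑ l, D.cartan l j • D.fund l) := by
    simp only [map_sum, map_zsmul]
  rw [map_sub, hroot] at h
  rw [hs, ← h, hfund]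
  abel

theorem form_fund_sub_wLe_of_coroot_eq_zero (i : ℕ → I) {x : P} (hx : ∀ j, D.coroot j x = 0)
    (y : P) (p : ℕ) : D.form (y - D.wLe i p y) x = 0 := by
  rw [map_sub, LinearMap.sub_apply]
  nth_rw 2 [← D.weylGroup_apply_of_coroot_eq_zero hx (D.wLe_mem i p)]
  rw [D.form_weylGroup (D.wLe_mem i p), sub_self]

theorem lamNat_exchange_of_le [Fintype I] (i : ℕ → I) {s p : ℕ} (h : s ≤ p) :
    D.lamNat i s (last i (i (p + 1)) p) - D.lamNat i s (last i (i (p + 1)) (p + 1)) +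
        ∑ l, (D.cartan l (i (p + 1)) : ℚ) * D.lamNat i s (last i l (p + 1)) =
      D.form (D.fund (i s) - D.wLe i s (D.fund (i s))) (D.root (i (p + 1))) := by
  have hk := D.form_fund_sub_wLe_of_coroot_eq_zero i (D.coroot_root_sub_sum_fund (i (p + 1)))
    (D.fund (i s)) s
  have hx := congrArg (D.form (D.fund (i s) - D.wLe i s (D.fund (i s)))) (D.wLe_add_wLe_pred i p)
  rw [map_neg, hk] at hx
  simp only [D.lamNat_last_of_ge i _ h, D.lamNat_last_of_ge i _ (h.trans p.le_succ), pairing]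
  generalize D.fund (i s) - D.wLe i s (D.fund (i s)) = V at *
  simp only [map_add, map_sub, map_sum, map_zsmul, zsmul_eq_mul, mul_add, Finset.sum_add_distrib]
    at hx hk ⊢
  linarith

theorem lamNat_exchange_of_ge [Fintype I] (i : ℕ → I) {s p : ℕ} (h : p + 1 ≤ s) :
    D.lamNat i s (last i (i (p + 1)) p) - D.lamNat i s (last i (i (p + 1)) (p + 1)) +
        ∑ l, (D.cartan l (i (p + 1)) : ℚ) * D.lamNat i s (last i l (p + 1)) =
      -D.form (D.root (i (p + 1))) (D.fund (i s) + D.wLe i s (D.fund (i s))) := by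
  have hx := congrArg (fun x => D.form x (D.fund (i s) + D.wLe i s (D.fund (i s))))
    (D.wLe_add_wLe_pred i p)
  simp only [D.lamNat_last_of_le i _ h, D.lamNat_last_of_le i _ (p.le_succ.trans h), pairing]
  generalize D.fund (i s) + D.wLe i s (D.fund (i s)) = V at *
  simp only [map_add, map_sub, map_neg, map_sum, map_zsmul, LinearMap.add_apply,
    LinearMap.sub_apply, LinearMap.neg_apply, LinearMap.sum_apply, LinearMap.smul_apply,
    zsmul_eq_mul, mul_sub, mul_neg, Finset.sum_sub_distrib, Finset.sum_neg_distrib] at hx ⊢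
  linarith

theorem lamNat_exchange_sub [Fintype I] (i : ℕ → I) (s p q : ℕ) (hpq : p < q)
    (hi : i (q + 1) = i (p + 1)) (hne : ∀ v, p + 1 < v → v ≤ q → i v ≠ i (p + 1)) :
    (D.lamNat i s (last i (i (p + 1)) p) - D.lamNat i s (last i (i (p + 1)) (p + 1)) +
        ∑ l, (D.cartan l (i (p + 1)) : ℚ) * D.lamNat i s (last i l (p + 1))) -
      (D.lamNat i s (last i (i (p + 1)) q) - D.lamNat i s (last i (i (p + 1)) (q + 1)) +
        ∑ l, (D.cartan l (i (p + 1)) : ℚ) * D.lamNat i s (last i l (q + 1))) =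
      if s = p + 1 then -2 * D.d (i s) else 0 := by
  have hq1 := fun h => D.lamNat_exchange_of_le i (s := s) (p := q) h
  have hq2 := fun h => D.lamNat_exchange_of_ge i (s := s) (p := q) h
  rw [hi] at hq1 hq2
  rcases Nat.lt_or_ge p s with h1 | h1
  · rw [D.lamNat_exchange_of_ge i h1]
    rcases Nat.lt_or_ge q s with h2 | h2
    · rw [hq2 h2, if_neg (by omega), sub_self]
    · rw [hq1 h2, D.form_symm (_ - _)]
      -- For p < s ≤ q the two exchange formulas differ in kind; the wϖ parts cancel.
      have hsum : ∀ a b c : P, -D.form a (b + c) - D.form a (b - c) = -2 * D.form a b := by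
        intro a b c
        rw [map_add, map_sub]; ring
      rw [hsum, form_root_eq]
      split_ifs with h3
      · subst h3
        rw [D.coroot_fund_same]; simp
      · rw [D.coroot_fund_of_ne _ _ (hne s (by omega) h2)]; simp
  · rw [D.lamNat_exchange_of_le i h1, hq1 (by omega), if_neg (by omega), sub_self]

/-! ### The entries of `B̃` -/

theorem lt_next_iff {r : ℕ∞} (i : ℕ → I) (u : J r) {p : ℕ} (hp : (p : ℕ∞) ≤ r) :
    (p : ℕ∞) < next r i u ↔ ∀ v : ℕ, u.1 < v → v ≤ p → i v ≠ i u := by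
  constructor
  · intro h v huv hvp hi
    refine (h.trans_le (sInf_le (Or.inl ⟨⟨v, by omega, ?_⟩, huv, hi, rfl⟩))).not_ge ?_
    · exact le_trans (by exact_mod_cast hvp) hp
    · exact_mod_cast hvp
  · intro h
    -- The bound p ≤ r ensures that the default value r + 1 also exceeds p.
    have h1 : ((p + 1 : ℕ) : ℕ∞) ≤ next r i u := by
      refine le_sInf ?_
      rintro m (⟨v, huv, hi, rfl⟩ | rfl)
      · by_contra hlt
        have : v.1 < p + 1 := by exact_mod_cast not_le.1 hlt
        exact h v.1 huv (by omega) hi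
      · push_cast
        gcongr
    exact lt_of_lt_of_le (by exact_mod_cast p.lt_succ_self) h1

theorem eq_next_iff {r : ℕ∞} (i : ℕ → I) (u : J r) {p : ℕ} (hp : (p : ℕ∞) ≤ r) :
    (p : ℕ∞) = next r i u ↔ u.1 < p ∧ i p = i u ∧ ∀ v : ℕ, u.1 < v → v < p → i v ≠ i u := by
  have hu := u.2.1
  constructor
  · intro h
    have h1 : ∀ v : ℕ, u.1 < v → v < p → i v ≠ i u := by
      cases p with
      | zero => intro v _ h; omega
      | succ q =>
        have hlt : (q : ℕ∞) < next r i u := by rw [← h]; exact_mod_cast q.lt_succ_self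
        have hq : (q : ℕ∞) ≤ r := le_trans (by exact_mod_cast q.le_succ) hp
        exact fun v hv hvq => (lt_next_iff i u hq).1 hlt v hv (by omega)
    have h2 := mt (lt_next_iff i u hp).2 (by rw [h]; exact lt_irrefl _)
    push Not at h2
    obtain ⟨v, h3, h4, h5⟩ := h2
    rcases h4.eq_or_lt with rfl | h6
    · exact ⟨h3, h5, h1⟩
    · exact absurd h5 (h1 v h3 h6)
  · rintro ⟨h1, h2, h3⟩
    refine le_antisymm ?_ (sInf_le (Or.inl ⟨⟨p, by omega, hp⟩, h1, h2, rfl⟩))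
    refine le_sInf ?_
    rintro m (⟨v, huv, hi, rfl⟩ | rfl)
    · by_contra hlt
      exact h3 v.1 huv (by exact_mod_cast not_le.1 hlt) hi
    · exact hp.trans le_self_add

theorem exists_next_eq {r : ℕ∞} {i : ℕ → I} (t : Je r i) :
    ∃ n : ℕ, (n : ℕ∞) ≤ r ∧ (n : ℕ∞) = next r i t.1 := by
  have h : next r i t.1 < r + 1 := lt_of_le_of_ne (sInf_le (Or.inr rfl)) t.2
  obtain ⟨n, hn⟩ := ENat.ne_top_iff_exists.1 (ne_top_of_lt h)
  exact ⟨n, Order.le_of_lt_add_one (hn.symm ▸ h), hn⟩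

open Classical in
theorem B_eq_of_eq {r : ℕ∞} {i : ℕ → I} (u : J r) (t : Je r i) {n : ℕ} (hr : (n : ℕ∞) ≤ r)
    (hn : (n : ℕ∞) = next r i t.1) (h : i u = i t.1) :
    D.B r i u t = (if u.1 = last i (i u) (t.1.1 - 1) then 1 else 0) -
      (if u.1 = n then 1 else 0) := by
  obtain ⟨hn1, hn2, hn3⟩ := (eq_next_iff i t.1 hr).1 hn
  have ht := t.1.2.1
  have h1 : ((t.1.1 : ℕ∞) = next r i u) ↔ u.1 = last i (i u) (t.1.1 - 1) := by
    rw [eq_next_iff i u t.1.2.2, eq_last_iff i u.2.1]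
    constructor
    · rintro ⟨a, _, b⟩
      exact ⟨by omega, fun v h1 h2 => b v h1 (by omega)⟩
    · rintro ⟨a, b⟩
      exact ⟨by omega, h.symm, fun v h1 h2 => b v h1 (by omega)⟩
  have h2 : ((u.1 : ℕ∞) < t.1.1 ∧ (t.1.1 : ℕ∞) < next r i u ∧
      next r i u < next r i t.1) ↔ False := by
    rw [iff_false]
    rintro ⟨a, b, _⟩
    exact (lt_next_iff i u t.1.2.2).1 b t.1.1 (by exact_mod_cast a) le_rfl h.symm
  have h3 : ((t.1.1 : ℕ∞) < u.1 ∧ (u.1 : ℕ∞) < next r i t.1 ∧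
      next r i t.1 < next r i u) ↔ False := by
    rw [iff_false]
    rintro ⟨a, b, _⟩
    exact (lt_next_iff i t.1 u.2.2).1 b u.1 (by exact_mod_cast a) le_rfl h
  have hlast := last_le i (i u) (t.1.1 - 1)
  simp only [B, Matrix.of_apply, h2, h3, if_false, h1]
  simp only [← hn, Nat.cast_inj]
  split_ifs <;> omega

-- Here u is the last occurrence of its letter up to p exactly when u ≤ p < u⁺. Comparing p = t with
-- p = t⁺ yields the two interlacing patterns in the definition of B̃.
open Classical in
theorem B_eq_of_ne {r : ℕ∞} {i : ℕ → I} (u : J r) (t : Je r i) {n : ℕ} (hr : (n : ℕ∞) ≤ r)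
    (hn : (n : ℕ∞) = next r i t.1) (h : i u ≠ i t.1) :
    D.B r i u t = D.cartan (i u) (i t.1) * ((if u.1 = last i (i u) t.1.1 then 1 else 0) -
      (if u.1 = last i (i u) n then 1 else 0)) := by
  obtain ⟨hn1, hn2, hn3⟩ := (eq_next_iff i t.1 hr).1 hn
  have ht := t.1.2.1
  have h1 : ((t.1.1 : ℕ∞) = next r i u) ↔ False := by
    rw [iff_false, eq_next_iff i u t.1.2.2]
    exact fun h' => h h'.2.1.symm
  have h2 : (n : ℕ∞) ≠ next r i u := by
    rw [Ne, eq_next_iff i u hr]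
    exact fun h' => h (h'.2.1.symm.trans hn2)
  have h2' : next r i u < n ↔ ¬ (n : ℕ∞) < next r i u := by
    rw [not_lt]
    exact ⟨le_of_lt, fun h' => lt_of_le_of_ne h' h2.symm⟩
  have hut : u.1 ≠ t.1.1 := fun h' => h (congrArg i h')
  have hun : u.1 ≠ n := fun h' => h ((congrArg i h').trans hn2)
  have hl1 : u.1 = last i (i u) t.1.1 ↔ u.1 ≤ t.1.1 ∧ (t.1.1 : ℕ∞) < next r i u := by
    rw [eq_last_iff i u.2.1, lt_next_iff i u t.1.2.2]
  have hl2 : u.1 = last i (i u) n ↔ u.1 ≤ n ∧ (n : ℕ∞) < next r i u := by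
    rw [eq_last_iff i u.2.1, lt_next_iff i u hr]
  have hmono : (n : ℕ∞) < next r i u → (t.1.1 : ℕ∞) < next r i u :=
    fun h' => lt_trans (by exact_mod_cast hn1) h'
  simp only [B, Matrix.of_apply, h1, if_false, hl1, hl2]
  simp only [← hn, Nat.cast_inj, hun, if_false, h2', Nat.cast_lt]
  by_cases ha : (n : ℕ∞) < next r i u
  · simp only [ha, hmono ha, not_true, and_false, and_true, if_false]
    split_ifs <;> omega
  · simp only [ha, not_false_eq_true, and_false, and_true, if_false]
    by_cases hb : (t.1.1 : ℕ∞) < next r i u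
    · simp only [hb, and_true]
      split_ifs <;> omega
    · simp [hb]

open Classical in
theorem B_eq_sum [Fintype I] {r : ℕ∞} {i : ℕ → I} (u : J r) (t : Je r i) {n : ℕ}
    (hr : (n : ℕ∞) ≤ r) (hn : (n : ℕ∞) = next r i t.1) :
    D.B r i u t = (if u.1 = last i (i t.1) (t.1.1 - 1) then 1 else 0) -
      (if u.1 = last i (i t.1) t.1.1 then 1 else 0) -
      (if u.1 = last i (i t.1) (n - 1) then 1 else 0) +
      (if u.1 = last i (i t.1) n then 1 else 0) +
      ∑ l, D.cartan l (i t.1) * ((if u.1 = last i l t.1.1 then 1 else 0) -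
        (if u.1 = last i l n then 1 else 0)) := by
  obtain ⟨hn1, hn2, hn3⟩ := (eq_next_iff i t.1 hr).1 hn
  have hu := u.2.1
  have ht := t.1.2.1
  have hne : ∀ l p, i u ≠ l → u.1 ≠ last i l p := by
    intro l p h1 h2
    have h3 := apply_last i l p (by omega)
    rw [← h2] at h3
    exact h1 h3
  rw [Finset.sum_eq_single (i u) (fun l _ hl => by
    rw [if_neg (hne l _ hl.symm), if_neg (hne l _ hl.symm)]; simp) (by simp)]
  by_cases h : i u = i t.1
  -- For equal letters, c_{j,j} = 2 contributes 2(e_t - e_n), and the other terms reduce the total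
  -- to e_{t⁻} - e_n, where t⁻ is the previous occurrence.
  · have hln : last i (i t.1) n = n := by rw [← hn2, last_self]
    have hlt : last i (i t.1) t.1.1 = t.1.1 := last_self i _
    have hln' : last i (i t.1) (n - 1) = t.1.1 := by
      symm
      rw [eq_last_iff i ht]
      exact ⟨by omega, fun v h1 h2 => hn3 v h1 (by omega)⟩
    rw [D.B_eq_of_eq u t hr hn h, h, D.isGCM.diag, hln, hlt, hln']
    ring
  · rw [D.B_eq_of_ne u t hr hn h]
    simp [hne _ _ h]

theorem le_of_B_ne_zero {r : ℕ∞} {i : ℕ → I} {u : J r} {t : Je r i} {n : ℕ}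
    (hr : (n : ℕ∞) ≤ r) (hn : (n : ℕ∞) = next r i t.1) (h : D.B r i u t ≠ 0) : u.1 ≤ n := by
  obtain ⟨hn1, _⟩ := (eq_next_iff i t.1 hr).1 hn
  by_cases hi : i u = i t.1
  · rw [D.B_eq_of_eq u t hr hn hi] at h
    have := last_le i (i u) (t.1.1 - 1)
    by_contra hlt
    exact h (by rw [if_neg (by omega), if_neg (by omega), sub_zero])
  · rw [D.B_eq_of_ne u t hr hn hi] at h
    have := last_le i (i u) t.1.1
    have := last_le i (i u) n
    by_contra hlt
    exact h (by rw [if_neg (by omega), if_neg (by omega), sub_zero, mul_zero])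

theorem finite_B_ne_zero {r : ℕ∞} {i : ℕ → I} (t : Je r i) :
    {u : J r | D.B r i u t ≠ 0}.Finite := by
  obtain ⟨n, hr, hn⟩ := exists_next_eq t
  refine Set.Finite.of_finite_image ((Set.finite_Iic n).subset ?_) Subtype.val_injective.injOn
  rintro _ ⟨u, hu, rfl⟩
  exact D.le_of_B_ne_zero hr hn hu

theorem lamNat_zero (i : ℕ → I) (s : ℕ) : D.lamNat i s 0 = 0 := by
  rw [D.lamNat_of_le i s.zero_le, pairing]
  simp [wLe]

theorem finsum_Lam_mul_B [Fintype I] {r : ℕ∞} {i : ℕ → I} (s : J r) (t : Je r i) :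
    ∑ᶠ u : J r, D.Lam r i s u * (D.B r i u t : ℚ) =
      if s = t.1 then -2 * D.d (i s) else 0 := by
  classical
  obtain ⟨n, hr, hn⟩ := exists_next_eq t
  obtain ⟨hn1, hn2, hn3⟩ := (eq_next_iff i t.1 hr).1 hn
  have ht := t.1.2.1
  let b : ℕ → ℚ := fun u => (if u = last i (i t.1) (t.1.1 - 1) then 1 else 0) -
      (if u = last i (i t.1) t.1.1 then 1 else 0) -
      (if u = last i (i t.1) (n - 1) then 1 else 0) +
      (if u = last i (i t.1) n then 1 else 0) +
      ∑ l, (D.cartan l (i t.1) : ℚ) * ((if u = last i l t.1.1 then 1 else 0) -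
        (if u = last i l n then 1 else 0))
  have hB : ∀ u : J r, D.Lam r i s u * (D.B r i u t : ℚ) = D.lamNat i s u.1 * b u.1 := by
    intro u
    rw [D.B_eq_sum u t hr hn]
    push_cast
    rfl
  have hlast : ∀ l p, p ≤ n →
      ∑ u ∈ Finset.range (n + 1), D.lamNat i s u * (if u = last i l p then 1 else 0) =
        D.lamNat i s (last i l p) := by
    intro l p hp
    have := last_le i l p
    simp only [mul_ite, mul_one, mul_zero]
    rw [Finset.sum_ite_eq', if_pos (Finset.mem_range.2 (by omega))]
  have hsum : ∑ᶠ u : J r, D.Lam r i s u * (D.B r i u t : ℚ) =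
      ∑ u ∈ Finset.range (n + 1), D.lamNat i s u * b u := by
    let e : ℕ → Prop := fun u => 1 ≤ u ∧ (u : ℕ∞) ≤ r
    rw [finsum_congr hB, finsum_subtype_eq_finsum_cond e (f := fun u => D.lamNat i s u * b u)]
    rw [finsum_eq_sum_of_support_subset (s := Finset.range (n + 1))]
    · refine Finset.sum_congr rfl fun u hu => ?_
      rw [finsum_eq_if]
      split_ifs with h
      · rfl
      · have hle : (u : ℕ∞) ≤ r :=
          le_trans (by exact_mod_cast Nat.lt_succ_iff.1 (Finset.mem_range.1 hu)) hr
        obtain rfl : u = 0 := by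
          by_contra h0
          exact h ⟨by omega, hle⟩
        -- The range includes the index 0, which is outside J and stands for a missing occurrence; Λ
        -- vanishes there.
        rw [lamNat_zero, zero_mul]
    · intro u hu
      rw [Function.mem_support, finsum_eq_if] at hu
      split_ifs at hu with h
      · have h1 := hB ⟨u, h⟩
        have h2 : D.B r i ⟨u, h⟩ t ≠ 0 := by
          intro h0
          rw [h0, Int.cast_zero, mul_zero] at h1
          exact hu h1.symm
        have h3 := D.le_of_B_ne_zero hr hn h2
        simpa using Nat.lt_succ_of_le h3
      · exact absurd rfl hu
  rw [hsum]
  simp only [b, mul_add, mul_sub, Finset.sum_add_distrib, Finset.sum_sub_distrib, Finset.mul_sum,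
    mul_left_comm (D.lamNat i s _)]
  rw [Finset.sum_comm (s := Finset.range (n + 1)), Finset.sum_comm (s := Finset.range (n + 1))]
  simp only [← Finset.mul_sum]
  simp only [hlast _ _ hn1.le, hlast _ _ le_rfl, hlast _ (n - 1) (by omega),
    hlast _ (t.1.1 - 1) (by omega)]
  have key := D.lamNat_exchange_sub i s (t.1.1 - 1) (n - 1) (by omega)
  rw [Nat.sub_add_cancel ht, Nat.sub_add_cancel (by omega)] at key
  have := key hn2 fun v h1 h2 => hn3 v h1 (by omega)
  simp only [Subtype.ext_iff]
  rw [← this]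
  ring

end CartanDatum

theorem mainTheorem10 {I P : Type*} [AddCommGroup P] [Module.Free ℤ P]
    (D : CartanDatum I P) (hfin : D.IsFiniteType) (hconn : D.diagram.Connected)
    (hnorm : D.IsNormalized) (Q : D.DynkinQuiver) (r : ℕ∞) (i : ℕ → I)
    (hw : D.IsAdapted Q r i) :
    (∀ j : I, ∃ m : ℤ, 0 < m ∧ D.d j = m) ∧
    (∀ s t : CartanDatum.J r, ∃ m : ℤ, D.Lam r i s t = m) ∧
    (∀ t : CartanDatum.Je r i, {u : CartanDatum.J r | D.B r i u t ≠ 0}.Finite) ∧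
    ∀ (s : CartanDatum.J r) (t : CartanDatum.Je r i),
      ∑ᶠ u : CartanDatum.J r, D.Lam r i s u * (D.B r i u t : ℚ) =
        if s = t.1 then -2 * D.d (i s) else 0 := by
  have hd := D.exists_int_d_eq hfin hconn hnorm
  have hd' : ∀ j : I, ∃ m : ℤ, D.d j = m := fun j => (hd j).imp fun _ h => h.2
  have : Finite I := hfin.1
  have := Fintype.ofFinite I
  refine ⟨hd, fun s t => ?_, D.finite_B_ne_zero, D.finsum_Lam_mul_B⟩
  simp only [CartanDatum.Lam, Matrix.of_apply]
  split_ifs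
  · exact D.exists_int_lambdaUpper_eq hd' i s t
  · obtain ⟨m, hm⟩ := D.exists_int_lambdaUpper_eq hd' i t s
    exact ⟨-m, by rw [hm, Int.cast_neg]⟩
  · exact ⟨0, by simp⟩
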